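/- Theorem (Convergence to the ensemble average). Let $S\subset\mathbb R^2$ be a measurable surface domain of finite area $A$, and let $\lambda,z>0$, $k=2\pi/\lambda$. Let $h(r,r')$ be the Fresnel kernel $\frac{e^{ikz}}{i\lambda z}e^{i\frac{k}{2z}|r-r'|^2}$ or the exact kernel $\frac{1}{i\lambda d}e^{ikd}$ with $d=\sqrt{z^2+|r-r'|^2}$, and put $\mathcal P_z(V)(r)=\int_S h(r,r')V(r')\,d^2r'$. Let $\mathcal R(U)(r)=R(r)e^{i\phi_s(r)}U(r)$ with measurable $R:\mathbb R^2\to\mathbb C$, $\phi_s:\mathbb R^2\to\mathbb R$. For $\rho_c>0$ let $K_{\rho_c}(r,r')=f(|r-r'|/\rho_c)$ be an admissible coherence kernel, that is, Hermitian, positive semidefinite ($\iint\overline{\psi(r)}K_{\rho_c}(r,r')\psi(r')\,d^2r\,d^2r'\ge 0$ for integrable $\psi$), with $K_{\rho_c}(r,r)=1$. Assume that it is the coherence kernel of an extended source: $f(|v|)=\int B(\nu)e^{-2\pi i\nu\cdot v}\,d^2\nu$ for all $v\in\mathbb R^2$, with a bounded integrable brightness profile $B\ge 0$ that is continuous at $0$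 with $B(0)>0$. Let the surface coherence operator be $\mathcal C_{S,\rho_c}(V)(r)=\frac{1}{\rho_c^2B(0)}\int_S K_{\rho_c}(r,r')V(r')\,d^2r'$, the constant giving the kernel unit mass. Let $\rho_n>0$ be coherence lengths and let the integers $N_n$ (numbers of coherence cells) satisfy $N_n\sim A/(\pi\rho_n^2)$ and $N_n\to\infty$ (so $\rho_n\to 0$). Let $U_n(\omega,r)$ be jointly measurable random incident fields on a probability space $(\Omega,P)$; they may but need not depend on $n$. Assume that the total power after reflection remains finite: $\sup_n \mathbb E\int_S|\mathcal R(U_n)|^2<\infty$. (Instead of this it is enough that $\mathbb E\int_S|\mathcal R(U_n)|^2<\infty$ for each $n$ and that, for some $C$, $\mathbb E\big|\int_S g\,\mathcal R(U_n)\big|^2\le C\int_S|g|^2$ for all $n$ and all $g\in L^2(S)$.) Let $U_n^{(j)}=U_n(\xi_j,\cdot)$, $j=0,1,2,\dots$, be the realizations given by independent random points $\xi_j$ of $\Omega$ with law $P$. Fix a point $r$ of the detection plane. Then for every $n$ the fields $\mathcal P_z(\mathcal C_{S,\rho_n}(\mathcal R(U_n)))(r)$ and $\mathcal P_z(\mathcal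 R(U_n))(r)$ have finite second moments; $$\lim_{n\to\infty}\mathbb E\left|\mathcal P_z(\mathcal C_{S,\rho_n}(\mathcal R(U_n)))(r)-\mathcal P_z(\mathcal R(U_n))(r)\right|^2=0 ;$$ and there are real numbers $I_n$ (the ensemble intensities at $r$) such that, for each $n$, almost surely $$\lim_{M\to\infty}\frac1M\sum_{j=0}^{M-1}\left|\mathcal P_z(\mathcal R(U_n^{(j)}))(r)\right|^2=I_n ,$$ and the SECT intensity satisfies $$\lim_{n\to\infty}\Big(\mathbb E\left|\mathcal P_z(\mathcal C_{S,\rho_n}(\mathcal R(U_n)))(r)\right|^2-I_n\Big)=0 .$$ If moreover $I_n\to I$ (for instance if $U_n$ does not depend on $n$, where $I_n=I$), then the SECT intensity converges to the ensemble intensity $I$. -/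

import Mathlib

open MeasureTheory ProbabilityTheory Filter Topology Asymptotics
open scoped ENNReal FourierTransform ComplexConjugate

noncomputable section

namespace SECT

/-- Transverse coordinates: the Euclidean plane. -/
abbrev Plane : Type := EuclideanSpace ℝ (Fin 2)

/-! ### Operators of the framework -/

/-- Reflection operator: `R(U)(r) = R(r) exp(i φ_s(r)) U(r)`. -/
def reflect (R : Plane → ℂ) (φs : Plane → ℝ) (U : Plane → ℂ) (r : Plane) : ℂ :=
  R r * Complex.exp (Complex.I * (φs r : ℂ)) * U r

/-- Integral operator over the surface domain `S` with kernel `k`. Both the surface coherence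
operator (kernel `K_S`) and the propagation operator (kernel `h`) are of this form. -/
def kernelOp (S : Set Plane) (k : Plane → Plane → ℂ) (U : Plane → ℂ) (r : Plane) : ℂ :=
  ∫ r' in S, k r r' * U r'

/-- Fresnel (paraxial) propagation kernel over the distance `z` at wavelength `lam`,
with wavenumber `k = 2π / lam`. -/
def fresnelKernel (z lam : ℝ) (r r' : Plane) : ℂ :=
  Complex.exp (Complex.I * ((2 * Real.pi / lam * z : ℝ) : ℂ)) / (Complex.I * lam * z) *
    Complex.exp (Complex.I * ((2 * Real.pi / lam / (2 * z) * ‖r - r'‖ ^ 2 : ℝ) : ℂ))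

/-- Distance in space between the point `r` of the detection plane and the point `r'` of the
surface plane, the two planes being parallel at distance `z`. -/
def pathLength (z : ℝ) (r r' : Plane) : ℝ := Real.sqrt (z ^ 2 + ‖r - r'‖ ^ 2)

/-- Exact (spherical wave) propagation kernel `exp(i k d) / (i lam d)`, `d` the path length. -/
def exactKernel (z lam : ℝ) (r r' : Plane) : ℂ :=
  1 / (Complex.I * lam * (pathLength z r r' : ℂ)) *
    Complex.exp (Complex.I * ((2 * Real.pi / lam * pathLength z r r' : ℝ) : ℂ))

/-! ### Coherence kernels -/

/-- `K` is an admissible coherence kernel with coherence length `ρc` and shape `f`. -/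
structure IsAdmissibleKernel (K : Plane → Plane → ℂ) (ρc : ℝ) (f : ℝ → ℂ) : Prop where
  hermitian : ∀ r r', K r r' = conj (K r' r)
  posDef : ∀ ψ : Plane → ℂ, Integrable ψ →
    0 ≤ (∫ r, ∫ r', conj (ψ r) * K r r' * ψ r').re
  diag : ∀ r, K r r = 1
  scaling : ∀ r r', K r r' = f (‖r - r'‖ / ρc)

/-- The kernel shape `f` is the one produced by an extended incoherent source with (rescaled
angular) brightness distribution `B`: it is the Fourier transform of `B`. The source is bounded,
and bright and continuous at its centre. -/
structure IsSourceOf (B : Plane → ℝ) (f : ℝ → ℂ) : Prop where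
  nonneg : ∀ ν, 0 ≤ B ν
  integrable : Integrable B
  bounded : ∃ M : ℝ, ∀ ν, B ν ≤ M
  continuousAt_zero : ContinuousAt B 0
  pos_zero : 0 < B 0
  transform : ∀ v : Plane, f ‖v‖ = 𝓕 (fun ν : Plane => (B ν : ℂ)) v

/-- The kernel of the surface coherence operator: the coherence kernel `K` of coherence length `ρc`,
multiplied by the constant that gives it unit mass, so that uniform fields are preserved
(by Fourier inversion, `∫ f(|v| / ρc) dv = ρc² B(0)`). -/
def surfaceKernel (K : Plane → Plane → ℂ) (B : Plane → ℝ) (ρc : ℝ) (r r' : Plane) : ℂ :=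
  ((1 / (ρc ^ 2 * B 0) : ℝ) : ℂ) * K r r'

/-! ### Detected fields and powers -/

/-- Detected field in the SECT framework: `P_z (C_S (R U))`. -/
def detectedSECT (S : Set Plane) (h KS : Plane → Plane → ℂ) (R : Plane → ℂ) (φs : Plane → ℝ)
    (U : Plane → ℂ) : Plane → ℂ :=
  kernelOp S h (kernelOp S KS (reflect R φs U))

/-- Detected field of one realization in the traditional approach: `P_z (R U)`. -/
def detectedPlain (S : Set Plane) (h : Plane → Plane → ℂ) (R : Plane → ℂ) (φs : Plane → ℝ)
    (U : Plane → ℂ) : Plane → ℂ :=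
  kernelOp S h (reflect R φs U)

/-- Mean total optical power of the random field `V` over `S`. -/
def meanPower {Ω : Type*} [MeasurableSpace Ω] (P : Measure Ω) (S : Set Plane)
    (V : Ω → Plane → ℂ) : ℝ≥0∞ :=
  ∫⁻ ω, (∫⁻ r in S, ‖V ω r‖ₑ ^ 2) ∂P

/-- The optical power of the random fields `V n` remains finite as `n → ∞`: either the mean total
power is bounded in `n`, or (a weaker requirement, which also admits sequences of fields that
approach a delta-correlated one) each mean total power is finite and the mean power carried by
any normalized spatial mode `g` is bounded, uniformly in `n` and `g`. -/
def PowerRemainsFinite {Ω : Type*} [MeasurableSpace Ω] (P : Measure Ω) (S : Set Plane)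
    (V : ℕ → Ω → Plane → ℂ) : Prop :=
  (∃ C : ℝ≥0∞, C < ∞ ∧ ∀ n, meanPower P S (V n) ≤ C) ∨
  ((∀ n, meanPower P S (V n) < ∞) ∧
    ∃ C : ℝ, ∀ n, ∀ g : Plane → ℂ, MemLp g 2 (volume.restrict S) →
      ∫ ω, ‖∫ r in S, g r * V n ω r‖ ^ 2 ∂P ≤ C * ∫ r in S, ‖g r‖ ^ 2)

/-- SECT intensity at `r`: the mean of `|P_z (C_S (R U))(r)|²` over the random incident field. -/
def intensitySECT {Ω : Type*} [MeasurableSpace Ω] (P : Measure Ω) (S : Set Plane)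
    (h KS : Plane → Plane → ℂ) (R : Plane → ℂ) (φs : Plane → ℝ) (U : Ω → Plane → ℂ)
    (r : Plane) : ℝ :=
  ∫ ω, ‖detectedSECT S h KS R φs (U ω) r‖ ^ 2 ∂P

/-- Average of the detected intensity at `r` over the first `M` realizations `u 0, …, u (M - 1)`. -/
def sampleIntensity (S : Set Plane) (h : Plane → Plane → ℂ) (R : Plane → ℂ) (φs : Plane → ℝ)
    (u : ℕ → Plane → ℂ) (M : ℕ) (r : Plane) : ℝ :=
  (1 / (M : ℝ)) * ∑ j ∈ Finset.range M, ‖detectedPlain S h R φs (u j) r‖ ^ 2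

end SECT

end

noncomputable section

namespace SECT

/-! ### Fourier integrals and Plancherel's identity on L¹ ∩ L². -/

section Fourier

open scoped SchwartzMap

variable {V : Type*} [NormedAddCommGroup V] [InnerProductSpace ℝ V] [FiniteDimensional ℝ V]
  [MeasurableSpace V] [BorelSpace V]

/-! At a fixed `r`, propagation is a linear functional: it pairs the reflected field W with g = 1_S
h(r, ·). Since h(r, ·) is bounded and S has finite area, g lies in L¹ ∩ L². Fubini moves the
coherence operator onto g (`kernelOp_kernelOp_surfaceKernel`), so the SECT field is the pairing of W
with a deterministic function c_n, and the error is the pairing of W with c_n - g. Either power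
condition bounds its second moment by C ‖c_n - g‖² in L²(S) (`uniform_mode_bound`). All randomness
is thereby removed, and what remains is c_n → g in L².

The normalized coherence kernel is the Fourier transform of B(ρν)/B(0) (`fourier_symbol`), so c_n is
the Fourier multiplier with this symbol applied to g. The symbols are uniformly bounded and tend
pointwise to 1 as ρ → 0, because B is bounded and continuous at 0; Plancherel and dominated
convergence conclude (`tendsto_eLpNorm_surfaceKernel`).

The number I_n is the second moment of the plain detected field. Sample averages reach it by the
strong law, and SECT intensities approach it because mean-square closeness with bounded second
moments forces the second moments together (`tendsto_integral_sq_sub`). -/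

theorem continuous_fourier_of_integrable {g : V → ℂ} (hg : Integrable g) : Continuous (𝓕 g) :=
  VectorFourier.fourierIntegral_continuous Real.continuous_fourierChar continuous_inner hg

theorem continuous_fourierInv_of_integrable {g : V → ℂ} (hg : Integrable g) :
    Continuous (𝓕⁻ g) := by
  rw [Real.fourierInv_eq_fourier_comp_neg]
  exact continuous_fourier_of_integrable hg.comp_neg

theorem integral_fourier_mul {φ g : V → ℂ} (hφ : Integrable φ) (hg : Integrable g) :
    ∫ x, 𝓕 φ x * g x = ∫ x, φ x * 𝓕 g x := by
  simpa using! VectorFourier.integral_bilin_fourierIntegral_eq_flip (.mul ℂ ℂ) (L := innerₗ V)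
     Real.continuous_fourierChar continuous_inner hφ hg

theorem integral_fourierInv_mul {φ g : V → ℂ} (hφ : Integrable φ) (hg : Integrable g) :
    ∫ x, 𝓕⁻ φ x * g x = ∫ x, φ x * 𝓕⁻ g x := by
  have h1 : ∫ x, 𝓕⁻ φ x * g x = ∫ x, 𝓕 φ x * g (-x) := by
    rw [← integral_neg_eq_self]
    simp [Real.fourierInv_eq_fourier_neg]
  rw [h1, integral_fourier_mul hφ hg.comp_neg, Real.fourierInv_eq_fourier_comp_neg]

/-- On `L¹ ∩ L²`, the `L²` Fourier transform is given by the Fourier integral. -/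
theorem coeFn_fourier_toLp {g : V → ℂ} (hg : Integrable g) (hg2 : MemLp g 2) :
    (𝓕 (hg2.toLp g) : Lp (α := V) ℂ 2 volume) =ᵐ[volume] 𝓕 g := by
  apply ae_eq_of_integral_contDiff_smul_eq
    ((Lp.memLp _).locallyIntegrable one_le_two)
    (continuous_fourier_of_integrable hg).locallyIntegrable
  intro φ hφ hc
  have hc' : HasCompactSupport (fun x => (φ x : ℂ)) :=
    hc.comp_left (g := fun x : ℝ => (x : ℂ)) rfl
  set Φ := hc'.toSchwartzMap (Complex.ofRealCLM.contDiff.comp hφ) with hΦ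
  have hΦa : ∀ x, Φ x = (φ x : ℂ) := fun x => rfl
  -- The L² transform is also the distributional one, so in a pairing it passes to the test
  -- function; the Fourier integral does the same by `integral_fourier_mul`.
  have h1 := congrArg (fun T : 𝓢'(V, ℂ) => T Φ)
    (Lp.fourier_toTemperedDistribution_eq (hg2.toLp g))
  simp only [TemperedDistribution.fourier_apply, Lp.toTemperedDistribution_apply,
    smul_eq_mul] at h1
  have h2 : ∫ x, (𝓕 Φ) x * (hg2.toLp g) x = ∫ x, 𝓕 (⇑Φ) x * g x := by
    rw [← SchwartzMap.fourier_coe]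
    exact integral_congr_ae (by filter_upwards [hg2.coeFn_toLp] with x hx; rw [hx])
  rw [h2, integral_fourier_mul Φ.integrable hg] at h1
  simpa [hΦa] using h1.symm

/-- On `L¹ ∩ L²`, the inverse `L²` Fourier transform is given by the Fourier integral. -/
theorem coeFn_fourierInv_toLp {g : V → ℂ} (hg : Integrable g) (hg2 : MemLp g 2) :
    (𝓕⁻ (hg2.toLp g) : Lp (α := V) ℂ 2 volume) =ᵐ[volume] 𝓕⁻ g := by
  apply ae_eq_of_integral_contDiff_smul_eq
    ((Lp.memLp _).locallyIntegrable one_le_two)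
    (continuous_fourierInv_of_integrable hg).locallyIntegrable
  intro φ hφ hc
  have hc' : HasCompactSupport (fun x => (φ x : ℂ)) :=
    hc.comp_left (g := fun x : ℝ => (x : ℂ)) rfl
  set Φ := hc'.toSchwartzMap (Complex.ofRealCLM.contDiff.comp hφ) with hΦ
  have hΦa : ∀ x, Φ x = (φ x : ℂ) := fun x => rfl
  have h1 := congrArg (fun T : 𝓢'(V, ℂ) => T Φ)
    (Lp.fourierInv_toTemperedDistribution_eq (hg2.toLp g))
  simp only [TemperedDistribution.fourierInv_apply, Lp.toTemperedDistribution_apply,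
    smul_eq_mul] at h1
  have h2 : ∫ x, (𝓕⁻ Φ) x * (hg2.toLp g) x = ∫ x, 𝓕⁻ (⇑Φ) x * g x := by
    rw [← SchwartzMap.fourierInv_coe]
    exact integral_congr_ae (by filter_upwards [hg2.coeFn_toLp] with x hx; rw [hx])
  rw [h2, integral_fourierInv_mul Φ.integrable hg] at h1
  simpa [hΦa] using h1.symm

theorem memLp_two_fourier {g : V → ℂ} (hg : Integrable g) (hg2 : MemLp g 2) :
    MemLp (𝓕 g) 2 :=
  (memLp_congr_ae (coeFn_fourier_toLp hg hg2)).1 (Lp.memLp _)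

theorem memLp_two_fourierInv {g : V → ℂ} (hg : Integrable g) (hg2 : MemLp g 2) :
    MemLp (𝓕⁻ g) 2 :=
  (memLp_congr_ae (coeFn_fourierInv_toLp hg hg2)).1 (Lp.memLp _)

/-- Plancherel's identity for the difference of a function and an inverse Fourier integral. -/
theorem eLpNorm_fourierInv_sub {g H : V → ℂ} (hg : Integrable g) (hg2 : MemLp g 2)
    (hH : Integrable H) (hH2 : MemLp H 2) :
    eLpNorm (𝓕⁻ H - g) 2 = eLpNorm (H - 𝓕 g) 2 := by
  have h1 : eLpNorm (𝓕⁻ H - g) 2 volume =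
      ‖(𝓕⁻ (hH2.toLp H - 𝓕 (hg2.toLp g)) : Lp (α := V) ℂ 2 volume)‖ₑ := by
    -- `𝓕 g` need not be integrable, so g is recovered from it in `Lp`, where the transform is a
    -- unitary map.
    have hsub : (𝓕⁻ (hH2.toLp H - 𝓕 (hg2.toLp g)) : Lp (α := V) ℂ 2 volume) =
        𝓕⁻ (hH2.toLp H) - hg2.toLp g :=
      (map_sub (Lp.fourierTransformₗᵢ V ℂ).symm _ _).trans
        (congrArg _ ((Lp.fourierTransformₗᵢ V ℂ).symm_apply_apply (hg2.toLp g)))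
    rw [hsub, Lp.enorm_def]
    apply eLpNorm_congr_ae
    filter_upwards [Lp.coeFn_sub (μ := volume) (𝓕⁻ (hH2.toLp H)) (hg2.toLp g), hg2.coeFn_toLp,
      coeFn_fourierInv_toLp hH hH2] with x h1 h2 h3
    rw [h1, Pi.sub_apply, Pi.sub_apply, h2, h3]
  have h2 : ‖(𝓕⁻ (hH2.toLp H - 𝓕 (hg2.toLp g)) : Lp (α := V) ℂ 2 volume)‖ₑ =
      ‖hH2.toLp H - 𝓕 (hg2.toLp g)‖ₑ := by
    rw [← ofReal_norm, ← ofReal_norm]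
    congr 1
    exact (Lp.fourierTransformₗᵢ V ℂ).symm.norm_map _
  rw [h1, h2, Lp.enorm_def]
  apply eLpNorm_congr_ae
  filter_upwards [Lp.coeFn_sub (μ := volume) (hH2.toLp H) (𝓕 (hg2.toLp g)), hH2.coeFn_toLp,
    coeFn_fourier_toLp hg hg2] with x h1 h2 h3
  rw [h1, Pi.sub_apply, Pi.sub_apply, h2, h3]

/-- A Fourier multiplier acts as a convolution with the Fourier transform of its symbol. -/
theorem fourierInv_mul_fourier {m g : V → ℂ} (hm : Integrable m) (hg : Integrable g) (r : V) :
    𝓕⁻ (fun ν => m ν * 𝓕 g ν) r = ∫ x, 𝓕 m (x - r) * g x := by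
  -- The character of the inverse integral is absorbed into `m`: modulation by r translates `𝓕 m` by
  -- r.
  have hmr : Integrable (fun ν => (Real.fourierChar (inner ℝ ν r) : ℂ) * m ν) := by
    refine hm.bdd_mul (c := 1) ?_ ?_
    · exact (Continuous.aestronglyMeasurable (by fun_prop))
    · exact ae_of_all _ fun x => (Circle.norm_coe _).le
  have h1 : ∀ x, 𝓕 (fun ν => (Real.fourierChar (inner ℝ ν r) : ℂ) * m ν) x = 𝓕 m (x - r) := by
    intro x
    rw [Real.fourier_eq, Real.fourier_eq]
    congr 1; ext ν
    rw [Circle.smul_def, Circle.smul_def, inner_sub_right, neg_sub, sub_eq_add_neg,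
      AddChar.map_add_eq_mul]
    simp only [smul_eq_mul, Circle.coe_mul]
    ring
  calc _ = ∫ ν, ((Real.fourierChar (inner ℝ ν r) : ℂ) * m ν) * 𝓕 g ν := by
        rw [Real.fourierInv_eq]
        congr 1; ext ν
        rw [Circle.smul_def, smul_eq_mul, mul_assoc]
    _ = _ := by
        rw [← integral_fourier_mul hmr hg]
        simp_rw [h1]

/-- Bounded multipliers tending pointwise to `1` almost everywhere converge strongly on `L²`. -/
theorem tendsto_eLpNorm_mul_sub {α : Type*} [MeasurableSpace α] {μ : Measure α}
    {G : α → ℂ} (hG : MemLp G 2 μ) {m : ℕ → α → ℂ}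
    (hm : ∀ n, AEStronglyMeasurable (m n) μ) {M : ℝ} (hM : ∀ n x, ‖m n x‖ ≤ M)
    (hlim : ∀ x, Tendsto (fun n => m n x) atTop (𝓝 1)) :
    Tendsto (fun n => eLpNorm ((fun x => m n x * G x) - G) 2 μ) atTop (𝓝 0) := by
  have h0 : Tendsto (fun n => ∫⁻ x, ‖m n x * G x - G x‖ₑ ^ (2 : ℝ) ∂μ) atTop
      (𝓝 (∫⁻ x, 0 ∂μ)) := by
    apply tendsto_lintegral_of_dominated_convergence'
      (fun x => (ENNReal.ofReal (M + 1) * ‖G x‖ₑ) ^ (2 : ℝ))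
    · intro n
      exact ((((hm n).mul hG.1).sub hG.1).enorm).pow_const _
    · intro n
      refine ae_of_all _ fun x => ?_
      refine ENNReal.rpow_le_rpow ?_ zero_le_two
      have : m n x * G x - G x = (m n x - 1) * G x := by ring
      rw [this, enorm_mul]
      gcongr
      rw [← ofReal_norm]
      apply ENNReal.ofReal_le_ofReal
      calc _ ≤ ‖m n x‖ + ‖(1 : ℂ)‖ := norm_sub_le _ _
        _ ≤ _ := by simpa using hM n x
    · simp_rw [ENNReal.mul_rpow_of_nonneg _ _ zero_le_two]
      rw [lintegral_const_mul' _ _ (by simp)]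
      refine ENNReal.mul_ne_top (by simp) ?_
      have := lintegral_rpow_enorm_lt_top_of_eLpNorm_lt_top two_ne_zero (by simp) hG.2
      simpa using this.ne
    · refine ae_of_all _ fun x => ?_
      have h1 : Tendsto (fun n => m n x * G x - G x) atTop (𝓝 0) := by
        simpa using ((hlim x).mul_const (G x)).sub_const (G x)
      have h2 := (h1.enorm).ennrpow_const 2
      simpa using h2
  simp only [lintegral_zero] at h0
  have h3 := h0.ennrpow_const (1 / 2)
  simp only [one_div, ENNReal.zero_rpow_of_pos (show (0:ℝ) < 2⁻¹ by norm_num)] at h3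
  simpa [eLpNorm_eq_lintegral_rpow_enorm_toReal] using h3

end Fourier

/-! ### Propagation kernels -/

theorem continuous_fresnelKernel (z lam : ℝ) (r : Plane) : Continuous (fresnelKernel z lam r) := by
  unfold fresnelKernel
  fun_prop

theorem norm_fresnelKernel (z lam : ℝ) (r r' : Plane) :
    ‖fresnelKernel z lam r r'‖ = ‖Complex.I * lam * z‖⁻¹ := by
  unfold fresnelKernel
  rw [norm_mul, norm_div, Complex.norm_exp_I_mul_ofReal, Complex.norm_exp_I_mul_ofReal, mul_one,
    one_div]

theorem le_pathLength (z : ℝ) (r r' : Plane) : z ≤ pathLength z r r' :=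
  Real.le_sqrt_of_sq_le (by nlinarith [sq_nonneg ‖r - r'‖])

theorem continuous_exactKernel {z lam : ℝ} (hz : 0 < z) (hlam : 0 < lam) (r : Plane) :
    Continuous (exactKernel z lam r) := by
  have hc : Continuous (pathLength z r) := by unfold pathLength; fun_prop
  unfold exactKernel
  refine Continuous.mul (Continuous.div continuous_const (by fun_prop) fun r' => ?_) (by fun_prop)
  have h1 : (pathLength z r r' : ℂ) ≠ 0 :=
    Complex.ofReal_ne_zero.2 (hz.trans_le (le_pathLength z r r')).ne'
  have h2 : (lam : ℂ) ≠ 0 := Complex.ofReal_ne_zero.2 hlam.ne'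
  exact mul_ne_zero (mul_ne_zero Complex.I_ne_zero h2) h1

theorem norm_exactKernel_le {z lam : ℝ} (hz : 0 < z) (hlam : 0 < lam) (r r' : Plane) :
    ‖exactKernel z lam r r'‖ ≤ 1 / (lam * z) := by
  have hd := le_pathLength z r r'
  unfold exactKernel
  rw [norm_mul, Complex.norm_exp_I_mul_ofReal, mul_one, norm_div, norm_mul, norm_mul,
    Complex.norm_I, norm_one, one_mul, Complex.norm_real, Complex.norm_real,
    Real.norm_of_nonneg hlam.le, Real.norm_of_nonneg (hz.le.trans hd)]
  gcongr

/-- At a fixed point of the detection plane, both propagation kernels are bounded and continuous. -/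
theorem propagationKernel_regular {z lam : ℝ} (hz : 0 < z) (hlam : 0 < lam)
    {h : Plane → Plane → ℂ} (hh : h = fresnelKernel z lam ∨ h = exactKernel z lam) (r : Plane) :
    Continuous (h r) ∧ ∃ C : ℝ, ∀ r', ‖h r r'‖ ≤ C := by
  rcases hh with rfl | rfl
  · exact ⟨continuous_fresnelKernel z lam r, _, fun r' => (norm_fresnelKernel z lam r r').le⟩
  · exact ⟨continuous_exactKernel hz hlam r, _, norm_exactKernel_le hz hlam r⟩

/-! ### The surface coherence operator as a Fourier multiplier -/

/-- The Fourier symbol of the normalized coherence kernel of coherence length `ρ`. -/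
def symbol (B : Plane → ℝ) (ρ : ℝ) (ν : Plane) : ℂ := ((B (ρ • ν) / B 0 : ℝ) : ℂ)

namespace IsSourceOf

variable {B : Plane → ℝ} {f : ℝ → ℂ}

theorem integrable_symbol (hB : IsSourceOf B f) {ρ : ℝ} (hρ : 0 < ρ) :
    Integrable (symbol B ρ) :=
  ((hB.integrable.comp_smul hρ.ne').div_const _).ofReal

theorem exists_norm_symbol_le (hB : IsSourceOf B f) :
    ∃ M : ℝ, ∀ ρ ν, ‖symbol B ρ ν‖ ≤ M := by
  obtain ⟨M, hM⟩ := hB.bounded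
  refine ⟨M / B 0, fun ρ ν => ?_⟩
  have h0 := hB.pos_zero
  rw [symbol, Complex.norm_real, Real.norm_of_nonneg (div_nonneg (hB.nonneg _) h0.le)]
  gcongr
  exact hM _

theorem memLp_two_symbol (hB : IsSourceOf B f) {ρ : ℝ} (hρ : 0 < ρ) :
    MemLp (symbol B ρ) 2 := by
  obtain ⟨M, hM⟩ := hB.exists_norm_symbol_le
  have hi := hB.integrable_symbol hρ
  rw [memLp_two_iff_integrable_sq_norm hi.1]
  simp_rw [sq]
  exact hi.norm.bdd_mul hi.1.norm (ae_of_all _ fun ν => by simpa using hM ρ ν)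

theorem tendsto_symbol (hB : IsSourceOf B f) {ρ : ℕ → ℝ} (hρ : Tendsto ρ atTop (𝓝 0))
    (ν : Plane) : Tendsto (fun n => symbol B (ρ n) ν) atTop (𝓝 1) := by
  have h1 : Tendsto (fun n => ρ n • ν) atTop (𝓝 0) := by simpa using hρ.smul_const ν
  have h2 := ((hB.continuousAt_zero.tendsto.comp h1).div_const (B 0)).ofReal
  simpa [symbol, Function.comp_def, div_self hB.pos_zero.ne'] using h2

/-- Dilating the symbol by ρ in dimension two produces the factor ρ⁻². With the division by B(0),
this is exactly the unit-mass constant of `surfaceKernel`. -/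
theorem fourier_symbol (hB : IsSourceOf B f) {ρ : ℝ} (hρ : 0 < ρ) (v : Plane) :
    𝓕 (symbol B ρ) v = ((1 / (ρ ^ 2 * B 0) : ℝ) : ℂ) * f (‖v‖ / ρ) := by
  have h1 : f (‖v‖ / ρ) = 𝓕 (fun ν : Plane => (B ν : ℂ)) (ρ⁻¹ • v) := by
    rw [← hB.transform, norm_smul, norm_inv, Real.norm_of_nonneg hρ.le, div_eq_inv_mul]
  have h2 := Measure.integral_comp_smul (volume : Measure Plane)
    (fun ν => (Real.fourierChar (-inner ℝ ν (ρ⁻¹ • v)) : ℂ) * (B ν : ℂ)) ρ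
  rw [h1, Real.fourier_eq, Real.fourier_eq]
  simp only [Circle.smul_def, smul_eq_mul]
  simp only [inner_smul_left, inner_smul_right, finrank_euclideanSpace_fin, abs_inv, abs_pow,
    sq_abs, Complex.real_smul] at h2
  have h3 : ∀ ν : Plane, (Real.fourierChar (-inner ℝ ν v) : ℂ) * symbol B ρ ν =
      (Real.fourierChar (-(ρ⁻¹ * (ρ * inner ℝ ν v))) : ℂ) * (B (ρ • ν) : ℂ) * (B 0 : ℂ)⁻¹ := by
    intro ν
    rw [inv_mul_cancel_left₀ hρ.ne', symbol, Complex.ofReal_div, div_eq_mul_inv, mul_assoc]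
  simp_rw [h3, integral_mul_const]
  simp only [conj_trivial] at h2
  rw [h2]
  simp only [inner_smul_right]
  push_cast
  rw [one_div, mul_inv]
  ring

theorem surfaceKernel_eq (hB : IsSourceOf B f) {K : Plane → Plane → ℂ} {ρ : ℝ} (hρ : 0 < ρ)
    (hK : IsAdmissibleKernel K ρ f) (x y : Plane) :
    surfaceKernel K B ρ x y = 𝓕 (symbol B ρ) (x - y) := by
  rw [surfaceKernel, hK.scaling, hB.fourier_symbol hρ]

theorem continuous_surfaceKernel (hB : IsSourceOf B f) {K : Plane → Plane → ℂ} {ρ : ℝ}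
    (hρ : 0 < ρ) (hK : IsAdmissibleKernel K ρ f) :
    Continuous fun p : Plane × Plane => surfaceKernel K B ρ p.1 p.2 := by
  simp_rw [hB.surfaceKernel_eq hρ hK]
  exact (continuous_fourier_of_integrable (hB.integrable_symbol hρ)).comp
    (continuous_fst.sub continuous_snd)

theorem norm_surfaceKernel_le (hB : IsSourceOf B f) {K : Plane → Plane → ℂ} {ρ : ℝ}
    (hρ : 0 < ρ) (hK : IsAdmissibleKernel K ρ f) (x y : Plane) :
    ‖surfaceKernel K B ρ x y‖ ≤ ∫ ν, ‖symbol B ρ ν‖ := by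
  rw [hB.surfaceKernel_eq hρ hK]
  exact VectorFourier.norm_fourierIntegral_le_integral_norm _ _ _ _ _

/-- The integration runs over the first argument of the kernel: this is the transposed operator, the
one that acts on the propagation kernel after Fubini. -/
theorem integral_surfaceKernel_mul (hB : IsSourceOf B f) {K : Plane → Plane → ℂ} {ρ : ℝ}
    (hρ : 0 < ρ) (hK : IsAdmissibleKernel K ρ f) {g : Plane → ℂ} (hg : Integrable g) :
    (fun x => ∫ y, surfaceKernel K B ρ y x * g y) = 𝓕⁻ (fun ν => symbol B ρ ν * 𝓕 g ν) := by
  ext x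
  rw [fourierInv_mul_fourier (hB.integrable_symbol hρ) hg]
  simp_rw [hB.surfaceKernel_eq hρ hK]

/-- A product of two L² functions is integrable, so its inverse Fourier integral makes sense
pointwise even when `𝓕 g` is not integrable. -/
theorem integrable_symbol_mul_fourier (hB : IsSourceOf B f) {ρ : ℝ} (hρ : 0 < ρ)
    {g : Plane → ℂ} (hg : Integrable g) (hg2 : MemLp g 2) :
    Integrable (fun ν => symbol B ρ ν * 𝓕 g ν) :=
  (hB.memLp_two_symbol hρ).integrable_mul (memLp_two_fourier hg hg2)

theorem memLp_symbol_mul_fourier (hB : IsSourceOf B f) {ρ : ℝ} (hρ : 0 < ρ)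
    {g : Plane → ℂ} (hg : Integrable g) (hg2 : MemLp g 2) :
    MemLp (fun ν => symbol B ρ ν * 𝓕 g ν) 2 := by
  obtain ⟨M, hM⟩ := hB.exists_norm_symbol_le
  exact MemLp.of_le_mul (memLp_two_fourier hg hg2)
    (hB.integrable_symbol_mul_fourier hρ hg hg2).1
    (ae_of_all _ fun ν => by rw [norm_mul]; gcongr; exact hM ρ ν)

theorem memLp_integral_surfaceKernel_mul (hB : IsSourceOf B f) {K : Plane → Plane → ℂ} {ρ : ℝ}
    (hρ : 0 < ρ) (hK : IsAdmissibleKernel K ρ f) {g : Plane → ℂ} (hg : Integrable g)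
    (hg2 : MemLp g 2) :
    MemLp (fun x => ∫ y, surfaceKernel K B ρ y x * g y) 2 := by
  rw [hB.integral_surfaceKernel_mul hρ hK hg]
  exact memLp_two_fourierInv (hB.integrable_symbol_mul_fourier hρ hg hg2)
    (hB.memLp_symbol_mul_fourier hρ hg hg2)

/-- The coherence operators converge strongly to the identity on `L²`. -/
theorem tendsto_eLpNorm_surfaceKernel (hB : IsSourceOf B f) {K : ℝ → Plane → Plane → ℂ}
    (hK : ∀ ρ, 0 < ρ → IsAdmissibleKernel (K ρ) ρ f) {ρ : ℕ → ℝ} (hρ : ∀ n, 0 < ρ n)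
    (hρ0 : Tendsto ρ atTop (𝓝 0)) {g : Plane → ℂ} (hg : Integrable g) (hg2 : MemLp g 2) :
    Tendsto (fun n => eLpNorm
      ((fun x => ∫ y, surfaceKernel (K (ρ n)) B (ρ n) y x * g y) - g) 2) atTop (𝓝 0) := by
  obtain ⟨M, hM⟩ := hB.exists_norm_symbol_le
  refine (tendsto_eLpNorm_mul_sub (memLp_two_fourier hg hg2)
    (fun n => (hB.integrable_symbol (hρ n)).1) (fun n => hM (ρ n))
    (hB.tendsto_symbol hρ0)).congr fun n => ?_
  rw [hB.integral_surfaceKernel_mul (hρ n) (hK _ (hρ n)) hg,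
    eLpNorm_fourierInv_sub hg hg2 (hB.integrable_symbol_mul_fourier (hρ n) hg hg2)
      (hB.memLp_symbol_mul_fourier (hρ n) hg hg2)]

/-- Transposition of the coherence operator onto the propagation kernel. -/
theorem kernelOp_kernelOp_surfaceKernel (hB : IsSourceOf B f) {K : Plane → Plane → ℂ} {ρ : ℝ}
    (hρ : 0 < ρ) (hK : IsAdmissibleKernel K ρ f) {S : Set Plane} (hS : MeasurableSet S)
    {h : Plane → Plane → ℂ} {r : Plane} (hh : IntegrableOn (h r) S) {W : Plane → ℂ}
    (hW : IntegrableOn W S) :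
    kernelOp S h (kernelOp S (surfaceKernel K B ρ) W) r =
      ∫ x in S, (∫ y, surfaceKernel K B ρ y x * S.indicator (h r) y) * W x := by
  -- Fubini applies because the surface kernel is bounded and h(r, y) W(x) is integrable on the
  -- product.
  have hint : Integrable (Function.uncurry fun y x => h r y * (surfaceKernel K B ρ y x * W x))
      ((volume.restrict S).prod (volume.restrict S)) := by
    have h1 := (hh.mul_prod hW).bdd_mul (c := ∫ ν, ‖symbol B ρ ν‖)
      (hB.continuous_surfaceKernel hρ hK).aestronglyMeasurable
      (ae_of_all _ fun p => hB.norm_surfaceKernel_le hρ hK p.1 p.2)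
    refine h1.congr (ae_of_all _ fun p => ?_)
    simp only [Function.uncurry]
    ring
  unfold kernelOp
  simp_rw [← integral_const_mul]
  rw [integral_integral_swap hint]
  congr 1; ext x
  rw [← integral_mul_const, ← integral_indicator hS]
  congr 1; ext y
  by_cases hy : y ∈ S <;> simp [hy]
  ring

end IsSourceOf

/-- Coherence lengths vanish when the number of coherence cells becomes infinite. -/
theorem tendsto_coherenceLength {A : ℝ} {ρ : ℕ → ℝ} (hρ : ∀ n, 0 < ρ n) {N : ℕ → ℕ}
    (hN : (fun n => (N n : ℝ)) ~[atTop] fun n => A / (Real.pi * ρ n ^ 2))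
    (hNtop : Tendsto N atTop atTop) : Tendsto ρ atTop (𝓝 0) := by
  have h1 : Tendsto (fun n => A / (Real.pi * ρ n ^ 2)) atTop atTop :=
    hN.tendsto_atTop (tendsto_natCast_atTop_atTop.comp hNtop)
  have h2 : Tendsto (fun n => A / Real.pi * (A / (Real.pi * ρ n ^ 2))⁻¹) atTop (𝓝 0) := by
    simpa using h1.inv_tendsto_atTop.const_mul (A / Real.pi)
  have h3 : Tendsto (fun n => ρ n ^ 2) atTop (𝓝 0) := by
    refine h2.congr' ?_
    filter_upwards [h1.eventually_gt_atTop 0] with n hn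
    -- A null area would make the quotient vanish, although it tends to infinity.
    have hA : A ≠ 0 := by rintro rfl; simp at hn
    have := (hρ n).ne'
    field_simp
  have h4 := h3.sqrt
  simpa [Real.sqrt_sq (hρ _).le] using h4

/-! ### Spatial modes of random fields -/

section Modes

variable {Ω : Type*} [MeasurableSpace Ω] {P : Measure Ω} {S : Set Plane} {W : Ω → Plane → ℂ}
  {q : Plane → ℂ}

theorem aestronglyMeasurable_mode [SFinite P] (hW : Measurable (Function.uncurry W))
    (hq : AEStronglyMeasurable q (volume.restrict S)) :
    AEStronglyMeasurable (fun ω => ∫ x in S, q x * W ω x) P :=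
  AEStronglyMeasurable.integral_prod_right'
    (f := fun p : Ω × Plane => q p.2 * W p.1 p.2) (hq.comp_snd.mul hW.aestronglyMeasurable)

/-- Cauchy–Schwarz, in extended form so that no integrability of w is needed. -/
theorem enorm_mode_sq_le {w : Plane → ℂ} (hw : Measurable w)
    (hq : AEStronglyMeasurable q (volume.restrict S)) :
    ‖∫ x in S, q x * w x‖ₑ ^ 2 ≤ (∫⁻ x in S, ‖q x‖ₑ ^ 2) * ∫⁻ x in S, ‖w x‖ₑ ^ 2 := by
  have h1 : ‖∫ x in S, q x * w x‖ₑ ≤ (∫⁻ x in S, ‖q x‖ₑ ^ (2 : ℝ)) ^ (1 / (2 : ℝ)) *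
      (∫⁻ x in S, ‖w x‖ₑ ^ (2 : ℝ)) ^ (1 / (2 : ℝ)) := by
    refine (enorm_integral_le_lintegral_enorm _).trans ?_
    simp_rw [enorm_mul]
    exact ENNReal.lintegral_mul_le_Lp_mul_Lq _ Real.HolderConjugate.two_two hq.enorm
      hw.enorm.aemeasurable
  calc _ ≤ _ := pow_le_pow_left' h1 2
    _ = _ := by
      rw [mul_pow, ← ENNReal.rpow_natCast, ← ENNReal.rpow_natCast, ← ENNReal.rpow_mul,
        ← ENNReal.rpow_mul]
      norm_num

theorem lintegral_mode_sq_le (hW : Measurable (Function.uncurry W))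
    (hq : AEStronglyMeasurable q (volume.restrict S)) (hq2 : ∫⁻ x in S, ‖q x‖ₑ ^ 2 ≠ ∞) :
    ∫⁻ ω, ‖∫ x in S, q x * W ω x‖ₑ ^ 2 ∂P ≤ (∫⁻ x in S, ‖q x‖ₑ ^ 2) * meanPower P S W := by
  rw [meanPower, ← lintegral_const_mul' _ _ hq2]
  exact lintegral_mono fun ω => enorm_mode_sq_le hW.of_uncurry_left hq

theorem lintegral_enorm_sq_eq {α : Type*} [MeasurableSpace α] {μ : Measure α} {g : α → ℂ}
    (hg : MemLp g 2 μ) : ∫⁻ x, ‖g x‖ₑ ^ 2 ∂μ = ENNReal.ofReal (∫ x, ‖g x‖ ^ 2 ∂μ) := by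
  rw [ofReal_integral_eq_lintegral_ofReal ((memLp_two_iff_integrable_sq_norm hg.1).1 hg)
    (ae_of_all _ fun x => by positivity)]
  congr 1; ext x
  rw [ENNReal.ofReal_pow (norm_nonneg _), ofReal_norm]

theorem memLp_two_of_lintegral_sq {α : Type*} [MeasurableSpace α] {μ : Measure α} {g : α → ℂ}
    (hg : AEStronglyMeasurable g μ) (h : ∫⁻ x, ‖g x‖ₑ ^ 2 ∂μ < ∞) : MemLp g 2 μ := by
  rw [memLp_two_iff_integrable_sq_norm hg]
  refine ⟨(hg.norm.pow 2), ?_⟩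
  simpa [HasFiniteIntegral, enorm_pow] using h

theorem memLp_mode [SFinite P] (hW : Measurable (Function.uncurry W))
    (hq : MemLp q 2 (volume.restrict S)) (hfin : meanPower P S W < ∞) :
    MemLp (fun ω => ∫ x in S, q x * W ω x) 2 P := by
  have hq2 : ∫⁻ x in S, ‖q x‖ₑ ^ 2 ≠ ∞ := by rw [lintegral_enorm_sq_eq hq]; simp
  exact memLp_two_of_lintegral_sq (aestronglyMeasurable_mode hW hq.1)
    ((lintegral_mode_sq_le hW hq.1 hq2).trans_lt (ENNReal.mul_lt_top hq2.lt_top hfin))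

theorem ae_memLp_two (hW : Measurable (Function.uncurry W)) (hfin : meanPower P S W < ∞) :
    ∀ᵐ ω ∂P, MemLp (W ω) 2 (volume.restrict S) := by
  have hm : Measurable fun ω => ∫⁻ x in S, ‖W ω x‖ₑ ^ 2 :=
    (hW.enorm.pow_const 2).lintegral_prod_right'
  filter_upwards [ae_lt_top hm hfin.ne] with ω hω
  exact memLp_two_of_lintegral_sq hW.of_uncurry_left.aestronglyMeasurable hω

/-- Under either form of the power condition, spatial modes have uniformly bounded mean power. -/
theorem PowerRemainsFinite.uniform_mode_bound [SFinite P] {V : ℕ → Ω → Plane → ℂ}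
    (hV : ∀ n, Measurable (Function.uncurry (V n))) (h : PowerRemainsFinite P S V) :
    (∀ n, meanPower P S (V n) < ∞) ∧
      ∃ C : ℝ, ∀ n, ∀ g : Plane → ℂ, MemLp g 2 (volume.restrict S) →
        ∫ ω, ‖∫ r in S, g r * V n ω r‖ ^ 2 ∂P ≤ C * ∫ r in S, ‖g r‖ ^ 2 := by
  rcases h with ⟨C, hC, hle⟩ | h
  · have hfin : ∀ n, meanPower P S (V n) < ∞ := fun n => (hle n).trans_lt hC
    refine ⟨hfin, C.toReal, fun n g hg => ?_⟩
    have hm := memLp_mode (hV n) hg (hfin n)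
    have hg2 : ∫⁻ x in S, ‖g x‖ₑ ^ 2 ≠ ∞ := by rw [lintegral_enorm_sq_eq hg]; simp
    have h1 := (lintegral_mode_sq_le (P := P) (hV n) hg.1 hg2).trans
      (mul_le_mul_right (hle n) _)
    have h0 : 0 ≤ ∫ r in S, ‖g r‖ ^ 2 := integral_nonneg fun _ => by positivity
    rw [lintegral_enorm_sq_eq hm, lintegral_enorm_sq_eq hg, ← ENNReal.ofReal_toReal hC.ne,
      ← ENNReal.ofReal_mul h0, mul_comm] at h1
    exact (ENNReal.ofReal_le_ofReal_iff (by positivity)).1 h1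
  · exact h

end Modes

/-! ### Comparison of intensities -/

/-- Mean-square convergence of differences, with bounded second moments, gives convergence of the
differences of second moments. -/
theorem tendsto_integral_sq_sub {Ω : Type*} [MeasurableSpace Ω] {P : Measure Ω}
    {a b : ℕ → Ω → ℂ} (ha : ∀ n, MemLp (a n) 2 P) (hb : ∀ n, MemLp (b n) 2 P) {C : ℝ}
    (hC : ∀ n, ∫ ω, ‖b n ω‖ ^ 2 ∂P ≤ C)
    (hab : Tendsto (fun n => ∫ ω, ‖a n ω - b n ω‖ ^ 2 ∂P) atTop (𝓝 0)) :
    Tendsto (fun n => ∫ ω, ‖a n ω‖ ^ 2 ∂P - ∫ ω, ‖b n ω‖ ^ 2 ∂P) atTop (𝓝 0) := by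
  have key : ∀ {g : Ω → ℂ}, MemLp g 2 P →
      (eLpNorm g 2 P).toReal = Real.sqrt (∫ ω, ‖g ω‖ ^ 2 ∂P) := by
    intro g hg
    rw [hg.eLpNorm_eq_integral_rpow_norm two_ne_zero (by simp),
      ENNReal.toReal_ofReal (by positivity)]
    simp [Real.sqrt_eq_rpow]
  have tri : ∀ {u v : Ω → ℂ}, MemLp u 2 P → MemLp v 2 P →
      (eLpNorm (u + v) 2 P).toReal ≤ (eLpNorm u 2 P).toReal + (eLpNorm v 2 P).toReal := by
    intro u v hu hv
    rw [← ENNReal.toReal_add hu.2.ne hv.2.ne]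
    exact ENNReal.toReal_mono (ENNReal.add_ne_top.2 ⟨hu.2.ne, hv.2.ne⟩)
      (eLpNorm_add_le hu.1 hv.1 one_le_two)
  set α := fun n => Real.sqrt (∫ ω, ‖a n ω‖ ^ 2 ∂P) with hα
  set β := fun n => Real.sqrt (∫ ω, ‖b n ω‖ ^ 2 ∂P) with hβ
  set δ := fun n => Real.sqrt (∫ ω, ‖a n ω - b n ω‖ ^ 2 ∂P) with hδ
  have hδ0 : Tendsto δ atTop (𝓝 0) := by simpa using hab.sqrt
  have h1 : ∀ n, α n ≤ δ n + β n := fun n => by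
    have := tri ((ha n).sub (hb n)) (hb n)
    rw [sub_add_cancel, key (ha n), key (hb n), key ((ha n).sub (hb n))] at this
    exact this
  have h2 : ∀ n, β n ≤ δ n + α n := fun n => by
    have := tri ((hb n).sub (ha n)) (ha n)
    rw [sub_add_cancel, key (ha n), key (hb n), key ((hb n).sub (ha n))] at this
    simpa [hδ, norm_sub_rev] using this
  have hβC : ∀ n, β n ≤ Real.sqrt C := fun n => Real.sqrt_le_sqrt (hC n)
  have hδn : ∀ n, 0 ≤ δ n := fun n => Real.sqrt_nonneg _
  have hαn : ∀ n, 0 ≤ α n := fun n => Real.sqrt_nonneg _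
  have hβn : ∀ n, 0 ≤ β n := fun n => Real.sqrt_nonneg _
  -- Factor α² - β² = (α + β)(α - β), with |α - β| ≤ δ and α + β ≤ δ + 2β ≤ δ + 2√C.
  have hlim : Tendsto (fun n => δ n * (δ n + 2 * Real.sqrt C)) atTop (𝓝 0) := by
    simpa using hδ0.mul (hδ0.add_const (2 * Real.sqrt C))
  refine squeeze_zero_norm (fun n => ?_) hlim
  have ea : ∫ ω, ‖a n ω‖ ^ 2 ∂P = α n ^ 2 :=
    (Real.sq_sqrt (integral_nonneg fun _ => by positivity)).symm
  have eb : ∫ ω, ‖b n ω‖ ^ 2 ∂P = β n ^ 2 :=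
    (Real.sq_sqrt (integral_nonneg fun _ => by positivity)).symm
  rw [ea, eb, sq_sub_sq, Real.norm_eq_abs, abs_mul, mul_comm]
  have hab1 : |α n - β n| ≤ δ n := abs_le.2 ⟨by linarith [h2 n], by linarith [h1 n]⟩
  have hab2 : |α n + β n| ≤ δ n + 2 * Real.sqrt C := by
    rw [abs_of_nonneg (add_nonneg (hαn n) (hβn n))]
    linarith [h1 n, hβC n]
  exact mul_le_mul hab1 hab2 (abs_nonneg _) (hδn n)

/-- Strong law of large numbers for a function of independent draws from `P`. -/
theorem ae_tendsto_average_draws {Ω Ω' : Type*} [MeasurableSpace Ω] [MeasurableSpace Ω']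
    {P : Measure Ω} {Q : Measure Ω'} {ξ : ℕ → Ω' → Ω} (hξ : ∀ j, Measurable (ξ j))
    (hξlaw : ∀ j, Q.map (ξ j) = P) (hξind : iIndepFun ξ Q) {Y : Ω → ℝ} (hY : Measurable Y)
    (hYi : Integrable Y P) :
    ∀ᵐ ω' ∂Q, Tendsto (fun M : ℕ => (1 / (M : ℝ)) * ∑ j ∈ Finset.range M, Y (ξ j ω')) atTop
      (𝓝 (∫ ω, Y ω ∂P)) := by
  have h0 : ∫ ω', Y (ξ 0 ω') ∂Q = ∫ ω, Y ω ∂P := by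
    rw [← hξlaw 0, integral_map (hξ 0).aemeasurable hY.aestronglyMeasurable]
  have h1 := strong_law_ae_real (μ := Q) (fun j ω' => Y (ξ j ω'))
    (by
      rw [← hξlaw 0] at hYi
      exact hYi.comp_measurable (hξ 0))
    (fun i j hij => (hξind.indepFun hij).comp hY hY)
    (fun i => IdentDistrib.comp ⟨(hξ i).aemeasurable, (hξ 0).aemeasurable, by
      rw [hξlaw, hξlaw]⟩ hY)
  rw [h0] at h1
  filter_upwards [h1] with ω' h
  refine h.congr fun M => ?_
  rw [one_div, div_eq_inv_mul]

theorem measurable_reflect {Ω : Type*} [MeasurableSpace Ω] {R : Plane → ℂ} (hR : Measurable R)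
    {φs : Plane → ℝ} (hφs : Measurable φs) {U : Ω → Plane → ℂ}
    (hU : Measurable fun p : Ω × Plane => U p.1 p.2) :
    Measurable (Function.uncurry fun ω => reflect R φs (U ω)) := by
  unfold reflect Function.uncurry
  exact ((hR.comp measurable_snd).mul (Complex.measurable_exp.comp
    ((Complex.measurable_ofReal.comp (hφs.comp measurable_snd)).const_mul _))).mul hU

end SECT

end

/-! ### Assembly of the convergence theorem. -/

theorem mainTheorem5
    -- surface domain of finite area, wavelength, propagation distance and kernel
    (S : Set SECT.Plane) (hS : MeasurableSet S) (hSfin : volume S < ∞)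
    (lam z : ℝ) (hlam : 0 < lam) (hz : 0 < z)
    (h : SECT.Plane → SECT.Plane → ℂ)
    (hh : h = SECT.fresnelKernel z lam ∨ h = SECT.exactKernel z lam)
    -- reflection coefficient and surface phase
    (R : SECT.Plane → ℂ) (hR : Measurable R) (φs : SECT.Plane → ℝ) (hφs : Measurable φs)
    -- admissible coherence kernels, one for each coherence length
    (K : ℝ → SECT.Plane → SECT.Plane → ℂ) (f : ℝ → ℂ) (B : SECT.Plane → ℝ)
    (hK : ∀ ρc : ℝ, 0 < ρc → SECT.IsAdmissibleKernel (K ρc) ρc f)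
    (hB : SECT.IsSourceOf B f)
    -- coherence lengths and numbers of coherence cells
    (ρ : ℕ → ℝ) (hρ : ∀ n, 0 < ρ n) (N : ℕ → ℕ)
    (hN : (fun n => (N n : ℝ)) ~[atTop] fun n => volume.real S / (Real.pi * ρ n ^ 2))
    (hNtop : Tendsto N atTop atTop)
    -- random incident fields, possibly varying with the coherence length
    {Ω : Type*} [MeasurableSpace Ω] (P : Measure Ω) [IsProbabilityMeasure P]
    (U : ℕ → Ω → SECT.Plane → ℂ)
    (hU : ∀ n, Measurable (fun p : Ω × SECT.Plane => U n p.1 p.2))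
    (hpow : SECT.PowerRemainsFinite P S (fun n ω => SECT.reflect R φs (U n ω)))
    -- independent draws from the ensemble
    {Ω' : Type*} [MeasurableSpace Ω'] (Q : Measure Ω') [IsProbabilityMeasure Q]
    (ξ : ℕ → Ω' → Ω) (hξ : ∀ j, Measurable (ξ j)) (hξlaw : ∀ j, Q.map (ξ j) = P)
    (hξind : iIndepFun ξ Q)
    -- point of the detection plane
    (r : SECT.Plane) :
    -- the detected fields have finite mean intensity
    (∀ n, MemLp (fun ω => SECT.detectedSECT S h (SECT.surfaceKernel (K (ρ n)) B (ρ n)) R φs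
        (U n ω) r) 2 P) ∧
    (∀ n, MemLp (fun ω => SECT.detectedPlain S h R φs (U n ω) r) 2 P) ∧
    -- mean-square convergence of the detected fields
    Tendsto (fun n => ∫ ω, ‖SECT.detectedSECT S h (SECT.surfaceKernel (K (ρ n)) B (ρ n)) R φs
        (U n ω) r - SECT.detectedPlain S h R φs (U n ω) r‖ ^ 2 ∂P) atTop (𝓝 0) ∧
    -- the averages over independent realizations converge almost surely to ensemble intensities,
    -- and the SECT intensities converge to these
    ∃ I : ℕ → ℝ,
      (∀ n, ∀ᵐ ω' ∂Q, Tendsto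
        (fun M => SECT.sampleIntensity S h R φs (fun j => U n (ξ j ω')) M r) atTop (𝓝 (I n))) ∧
      Tendsto (fun n => SECT.intensitySECT P S h (SECT.surfaceKernel (K (ρ n)) B (ρ n)) R φs
        (U n) r - I n) atTop (𝓝 0) ∧
      (∀ I₀ : ℝ, Tendsto I atTop (𝓝 I₀) →
        Tendsto (fun n => SECT.intensitySECT P S h (SECT.surfaceKernel (K (ρ n)) B (ρ n)) R φs
          (U n) r) atTop (𝓝 I₀)) := by

  have hW : ∀ n, Measurable (Function.uncurry fun ω => SECT.reflect R φs (U n ω)) :=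
    fun n => SECT.measurable_reflect hR hφs (hU n)
  obtain ⟨hfin, C, hC⟩ := hpow.uniform_mode_bound hW
  obtain ⟨hhc, Ch, hhC⟩ := SECT.propagationKernel_regular hz hlam hh r
  have hρ0 : Tendsto ρ atTop (𝓝 0) := SECT.tendsto_coherenceLength hρ hN hNtop
  have : IsFiniteMeasure (volume.restrict S) := ⟨by simpa using hSfin⟩
  have hhS : ∀ p, MemLp (h r) p (volume.restrict S) := fun p =>
    MemLp.of_bound hhc.aestronglyMeasurable Ch (ae_of_all _ hhC)
  set g : SECT.Plane → ℂ := S.indicator (h r) with hg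
  have hg1 : Integrable g := (integrable_indicator_iff hS).2 (memLp_one_iff_integrable.1 (hhS 1))
  have hg2 : MemLp g 2 := (memLp_indicator_iff_restrict hS).2 (hhS 2)
  set c : ℕ → SECT.Plane → ℂ := fun n x =>
    ∫ y, SECT.surfaceKernel (K (ρ n)) B (ρ n) y x * g y with hc
  have hc2 : ∀ n, MemLp (c n) 2 := fun n =>
    hB.memLp_integral_surfaceKernel_mul (hρ n) (hK _ (hρ n)) hg1 hg2
  have hWS : ∀ n, ∀ᵐ ω ∂P, MemLp (SECT.reflect R φs (U n ω)) 2 (volume.restrict S) :=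
    fun n => SECT.ae_memLp_two (hW n) (hfin n)
  -- Only almost sure: the exchange of integrals needs the realization to be integrable on S, which
  -- finite mean power gives almost everywhere.
  have hsect : ∀ n, (fun ω => SECT.detectedSECT S h (SECT.surfaceKernel (K (ρ n)) B (ρ n)) R φs
      (U n ω) r) =ᵐ[P] fun ω => ∫ x in S, c n x * SECT.reflect R φs (U n ω) x := by
    intro n
    filter_upwards [hWS n] with ω hω
    exact hB.kernelOp_kernelOp_surfaceKernel (hρ n) (hK _ (hρ n)) hS
      (memLp_one_iff_integrable.1 (hhS 1)) (hω.integrable one_le_two)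
  have hSm : ∀ n, MemLp (fun ω => SECT.detectedSECT S h
      (SECT.surfaceKernel (K (ρ n)) B (ρ n)) R φs (U n ω) r) 2 P := fun n =>
    (memLp_congr_ae (hsect n)).2 (SECT.memLp_mode (hW n) ((hc2 n).restrict S) (hfin n))
  have hPm : ∀ n, MemLp (fun ω => SECT.detectedPlain S h R φs (U n ω) r) 2 P := fun n =>
    SECT.memLp_mode (hW n) (hhS 2) (hfin n)
  have hdiff : ∀ n, MemLp (fun x => c n x - h r x) 2 (volume.restrict S) := fun n =>
    ((hc2 n).restrict S).sub (hhS 2)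
  have hle : ∀ n, ∫ ω, ‖SECT.detectedSECT S h (SECT.surfaceKernel (K (ρ n)) B (ρ n)) R φs
      (U n ω) r - SECT.detectedPlain S h R φs (U n ω) r‖ ^ 2 ∂P ≤
      C * ∫ x in S, ‖c n x - h r x‖ ^ 2 := by
    intro n
    -- The error field is the mode c_n - h(r, ·) of the reflected field, so the uniform mode bound
    -- applies to it.
    refine le_trans (le_of_eq ?_) (hC n _ (hdiff n))
    apply integral_congr_ae
    filter_upwards [hsect n, hWS n] with ω h1 h2
    rw [h1, SECT.detectedPlain, SECT.kernelOp, ← integral_sub]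
    · simp_rw [sub_mul]
    · exact ((hc2 n).restrict S).integrable_mul h2
    · exact (hhS 2).integrable_mul h2
  have hmode : Tendsto (fun n => ∫ x in S, ‖c n x - h r x‖ ^ 2) atTop (𝓝 0) := by
    have h1 := hB.tendsto_eLpNorm_surfaceKernel hK hρ hρ0 hg1 hg2
    have h2 : Tendsto (fun n => eLpNorm (fun x => c n x - h r x) 2 (volume.restrict S)) atTop
        (𝓝 0) := by
      refine tendsto_of_tendsto_of_tendsto_of_le_of_le tendsto_const_nhds h1
        (fun n => zero_le) fun n => ?_
      -- On S the truncated kernel g equals h(r, ·), and restricting to S cannot increase the norm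
      -- over the whole plane.
      refine le_trans (le_of_eq (eLpNorm_congr_ae ?_)) (eLpNorm_restrict_le (c n - g) 2 volume S)
      filter_upwards [ae_restrict_mem hS] with x hx
      simp [hg, hx]
    have h3 := (ENNReal.tendsto_toReal ENNReal.zero_ne_top).comp h2
    have h4 := h3.pow 2
    simp only [ENNReal.toReal_zero, ne_eq, OfNat.ofNat_ne_zero, not_false_eq_true, zero_pow] at h4
    refine h4.congr fun n => ?_
    have h5 : 0 ≤ ∫ x in S, ‖c n x - h r x‖ ^ 2 := integral_nonneg fun _ => by positivity
    rw [Function.comp_apply, (hdiff n).eLpNorm_eq_integral_rpow_norm two_ne_zero (by simp),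
      ENNReal.toReal_ofReal (by positivity)]
    simp only [ENNReal.toReal_ofNat, Real.rpow_ofNat]
    rw [← Real.rpow_natCast, ← Real.rpow_mul h5]
    norm_num
  have hms := squeeze_zero (fun n => integral_nonneg fun _ => by positivity) hle
    (by simpa using hmode.const_mul C)
  -- The second moments of the plain field are bounded in n by the same mode bound, applied to h(r,
  -- ·) itself.
  have hint := SECT.tendsto_integral_sq_sub hSm hPm (fun n => hC n _ (hhS 2)) hms
  refine ⟨hSm, hPm, hms, fun n => ∫ ω, ‖SECT.detectedPlain S h R φs (U n ω) r‖ ^ 2 ∂P,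
    fun n => ?_, hint, fun I₀ hI => by simpa [SECT.intensitySECT] using hint.add hI⟩
  refine SECT.ae_tendsto_average_draws hξ hξlaw hξind ?_
    ((memLp_two_iff_integrable_sq_norm (hPm n).1).1 (hPm n))
  have hmeas : StronglyMeasurable fun ω => ∫ x in S, h r x * SECT.reflect R φs (U n ω) x :=
    StronglyMeasurable.integral_prod_right
      ((hhc.measurable.comp measurable_snd).mul (hW n)).stronglyMeasurable
  exact hmeas.measurable.norm.pow_const 2
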